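/- A one-player game of imperfect information against Nature is given by a finite set $A$ of actions, a finite set $D$ of directions, and a finite Mealy machine $M$ that reads histories $\tau\in\Gamma^*$, where $\Gamma=A\times D$, and outputs a finite sequence of observations. In each round the player chooses $a\in A$ and then Nature chooses $d\in D$. Two histories are indistinguishable, $\tau\sim\tau'$, if $M$ outputs the same observation sequence on both. A strategy structure is a (possibly infinite) set $V$ of nodes with an initial node, a transition function $V\times D\to V$ and an action choice $f:V\to A$. A history $a_0d_0\cdots a_{\ell-1}d_{\ell-1}$ follows it if, on the path $v_0,v_1,\dots,v_\ell$ that starts at the initial node $v_0$ and is determined by $d_0,\dots,d_{\ell-1}$, one has $a_k=f(v_k)$ for all $k<\ell$; the history then reaches $v_\ell$. It is required that $f(v)=f(v')$ whenever $v,v'$ are reached by indistinguishable histories that follow the structure. The outcome $H_S\subseteq\Gamma^*$ of the strategy structure $S$ is the tree of all histories that follow it. The winning condition is given by a nondeterministic parity tree automaton $\mathcal W=(R,\Delta,r_\varepsilon,\Omega)$ with a finite state set $R$, $\Delta\subseteq R\times A\times R^D$, $r_\varepsilon\in R$ and $\Omega:R\to\mathbb N$. Nothing requires it to depend on the player's observations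 only. $S$ is winning if there is a labelling $\rho:H_S\to R$ with $\rho(\varepsilon)=r_\varepsilon$ and $(\rho(\tau),a,(\rho(\tau ad))_{d\in D})\in\Delta$ for every $\tau\in H_S$, where $a=f(v)$ for the node $v$ reached by $\tau$, such that along every infinite play all of whose finite prefixes lie in $H_S$ the least priority $\Omega(\rho(\cdot))$ that occurs infinitely often is even. **Theorem.** If such a game with such a winning condition admits a winning strategy structure, on any set of nodes, then it admits a winning strategy structure on a finite set of nodes, that is, a finite-state winning strategy. -/

import Mathlib

open Filter

/-- A Mealy machine with state set `Q`, reading letters of `Γ` and writing letters of `B`. -/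
structure MealyMachine (Γ : Type*) (B : Type*) (Q : Type*) where
  /-- the transition function `δ` -/
  step : Q → Γ → Q
  /-- the output function `β` -/
  out : Q → Γ → B
  /-- the initial state -/
  init : Q

namespace MealyMachine

variable {Γ B Q : Type*}

/-- The observation sequence produced when the machine reads a word, starting in state `q`. -/
def outputFrom (M : MealyMachine Γ B Q) : Q → List Γ → List B
  | _, [] => []
  | q, α :: τ => M.out q α :: M.outputFrom (M.step q α) τ

/-- The observation sequence `β(τ)` produced on the history `τ`. -/
def output (M : MealyMachine Γ B Q) (τ : List Γ) : List B :=
  M.outputFrom M.init τ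

end MealyMachine

/-- A distributed game of a team `N` against Nature. Player `i` has the actions `A i` and the
observations `B i`, Nature has the directions `D`; a move is an action profile with a direction,
a history is a list of moves. The information of player `i` is given by a Mealy machine with
states `Q i` that reads histories. -/
structure DistributedGame (N : Type*) (A B Q : N → Type*) (D : Type*) where
  /-- the observation machine of each player -/
  machine : ∀ i, MealyMachine ((∀ j, A j) × D) (B i) (Q i)

/-- `τ ∼ⁱ τ'`: the two histories yield the same observation sequence for player `i`. -/
def DistributedGame.Indist {N : Type*} {A B Q : N → Type*} {D : Type*}
    (G : DistributedGame N A B Q D) (i : N) (τ τ' : List ((∀ j, A j) × D)) : Prop :=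
  (G.machine i).output τ = (G.machine i).output τ'

/-- A decision structure on the (possibly infinite) node set `V`, with action profiles `P` and
directions `D`. The edge relation is given by the transition function that it describes:
there is an edge from `v` to `v'` labelled `d` iff `v' = next v d`. -/
structure DecisionStructure (P : Type*) (D : Type*) (V : Type*) where
  /-- the deterministic transition function -/
  next : V → D → V
  /-- the action choice function `f` -/
  act : V → P
  /-- the initial node -/
  init : V

namespace DecisionStructure

variable {P D V : Type*}

/-- `S.Reaches τ v`: the history `τ` follows `S` and its path from the initial node ends in `v`. -/
inductive Reaches (S : DecisionStructure P D V) : List (P × D) → V → Prop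
  | nil : S.Reaches [] S.init
  | snoc {τ : List (P × D)} {v : V} (h : S.Reaches τ v) (d : D) :
      S.Reaches (τ ++ [(S.act v, d)]) (S.next v d)

/-- The outcome `H_S`: the tree (prefix-closed set) of all histories that follow `S`. -/
def outcome (S : DecisionStructure P D V) : Set (List (P × D)) :=
  {τ | ∃ v, S.Reaches τ v}

end DecisionStructure

/-- The uniformity relation `v ≈ⁱ v'` on the nodes of a decision structure: the two nodes are
reached by histories that follow `S` and are indistinguishable for player `i`. -/
def DecisionStructure.Uniform {N : Type*} {A B Q : N → Type*} {D V : Type*}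
    (S : DecisionStructure (∀ j, A j) D V) (G : DistributedGame N A B Q D) (i : N)
    (v v' : V) : Prop :=
  ∃ τ τ', G.Indist i τ τ' ∧ S.Reaches τ v ∧ S.Reaches τ' v'

/-- A decision structure is a strategy structure for `G` if each player's choices respect that
player's uniformity relation. -/
def DecisionStructure.IsStrategy {N : Type*} {A B Q : N → Type*} {D V : Type*}
    (S : DecisionStructure (∀ j, A j) D V) (G : DistributedGame N A B Q D) : Prop :=
  ∀ i v v', S.Uniform G i v v' → S.act v i = S.act v' i

/-- The (min-)parity condition: the least number that appears infinitely often exists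
and is even. -/
def ParityCondition (p : ℕ → ℕ) : Prop :=
  ∃ k, IsLeast {m | ∃ᶠ n in atTop, p n = m} k ∧ Even k

/-- A nondeterministic parity tree automaton with states `Q` for trees with directions `D` whose
nodes are labelled with action profiles in `P`. -/
structure TreeAutomaton (P : Type*) (D : Type*) (Q : Type*) where
  /-- the nondeterministic transition relation `Δ ⊆ Q × P × Q^D` -/
  trans : Set (Q × P × (D → Q))
  /-- the initial state -/
  init : Q
  /-- the priority of a state -/
  priority : Q → ℕ

namespace TreeAutomaton

variable {P D Q V : Type*}

/-- `ρ` is a run on the outcome of `S`. Only the values of `ρ` on `S.outcome` matter. -/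
def IsRun (W : TreeAutomaton P D Q) (S : DecisionStructure P D V) (ρ : List (P × D) → Q) : Prop :=
  ρ [] = W.init ∧
    ∀ τ v, S.Reaches τ v → (ρ τ, S.act v, fun d => ρ (τ ++ [(S.act v, d)])) ∈ W.trans

/-- `ρ` is accepting: along every play all of whose finite prefixes lie in the outcome of `S`,
the priorities satisfy the parity condition. -/
def IsAccepting (W : TreeAutomaton P D Q) (S : DecisionStructure P D V)
    (ρ : List (P × D) → Q) : Prop :=
  ∀ π : ℕ → P × D, (∀ n, (List.range n).map π ∈ S.outcome) →
    ParityCondition fun n => W.priority (ρ ((List.range n).map π))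

end TreeAutomaton

/-- `S` wins for the specification `W` if `W` has an accepting run on the outcome of `S`. -/
def DecisionStructure.IsWinning {P D Q V : Type*} (S : DecisionStructure P D V)
    (W : TreeAutomaton P D Q) : Prop :=
  ∃ ρ, W.IsRun S ρ ∧ W.IsAccepting S ρ

-- An accepting run on the outcome tree carries a progress measure: ordinal signatures, one entry
-- per priority, that do not increase up to the current priority and decrease at odd ones
-- (`exists_progress`). Conversely, a progress measure along a play forces the parity condition
-- (`parityCondition_of_progress`). Histories with the same observations, machine state and
-- automaton state are merged by keeping the least signature, since lowering the target preserves
-- progress. Each observation sequence thus yields an annotation, a map from the finite set of pairs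
-- of states to a well-order. The pointwise order on annotations is a well-quasi-order, so only
-- finitely many are minimal. Replacing each successor by a minimal annotation below it gives a
-- finite memory, which together with the machine state forms the nodes of the new strategy.

universe u v

/-! ### Signatures and the parity condition -/

/-- Parity signatures: tuples of ordinals indexed by the priorities below `K`, compared
lexicographically. -/
abbrev Signature (K : ℕ) := Lex (Fin K → Ordinal.{u})

namespace Signature

variable {K : ℕ}

/-- Forget the entries at the priorities above `p`. -/
noncomputable def trunc (p : ℕ) (x : Signature.{u} K) : Signature.{u} K :=
  toLex fun i => if (i : ℕ) ≤ p then x i else 0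

theorem trunc_mono (p : ℕ) : Monotone (trunc.{u} (K := K) p) := by
  intro x y h
  rcases h.eq_or_lt with rfl | ⟨i, hi, hlt⟩
  · exact le_rfl
  by_cases hp : (i : ℕ) ≤ p
  · refine le_of_lt ⟨i, fun j hj => ?_, ?_⟩
    · have : x j = y j := hi j hj
      simp [trunc, this]
    · simpa [trunc, hp] using hlt
  · refine le_of_eq (congrArg toLex (funext fun j => ?_))
    split_ifs with hj
    · exact hi j (Fin.lt_def.2 (by omega))
    · rfl

theorem trunc_trunc {k p : ℕ} (h : k ≤ p) (x : Signature.{u} K) :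
    trunc k (trunc p x) = trunc k x := by
  refine congrArg toLex (funext fun j => ?_)
  split_ifs with hj
  · simp [trunc, hj.trans h]
  · rfl

/-- The requirement that parity progress measures satisfy along an edge that leaves a vertex of
priority `p`. -/
def Progress (p : ℕ) (x y : Signature.{u} K) : Prop :=
  trunc p y ≤ trunc p x ∧ (Odd p → trunc p y < trunc p x)

/-- Truncation is monotone, so the target may be lowered; merging histories and passing to minimal
annotations both rest on this. -/
theorem Progress.mono {p : ℕ} {x y z : Signature.{u} K} (h : Progress p x y) (hz : z ≤ y) :
    Progress p x z :=
  ⟨(trunc_mono p hz).trans h.1, fun hp => (trunc_mono p hz).trans_lt (h.2 hp)⟩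

end Signature

theorem exists_isLeast_frequently_eq {p : ℕ → ℕ} {K : ℕ} (hK : ∀ n, p n < K) :
    ∃ k, IsLeast {m | ∃ᶠ n in atTop, p n = m} k := by
  have hne : {m | ∃ᶠ n in atTop, p n = m}.Nonempty := by
    by_contra! h
    have h' : ∀ m : Fin K, ∀ᶠ n in atTop, p n ≠ m := fun m => by
      have := Set.eq_empty_iff_forall_notMem.1 h (m : ℕ)
      simpa [Filter.Frequently] using this
    obtain ⟨n, hn⟩ := (eventually_all.2 h').exists
    exact hn ⟨p n, hK n⟩ rfl
  exact ⟨_, Nat.sInf_mem hne, fun _ => Nat.sInf_le⟩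

/-- A sequence of priorities that carries a progress measure satisfies the parity condition. -/
theorem parityCondition_of_progress {K : ℕ} {p : ℕ → ℕ} (hK : ∀ n, p n < K)
    (x : ℕ → Signature.{u} K) (hx : ∀ n, Signature.Progress (p n) (x n) (x (n + 1))) :
    ParityCondition p := by
  obtain ⟨k, hk⟩ := exists_isLeast_frequently_eq hK
  refine ⟨k, hk, ?_⟩
  by_contra hodd
  rw [Nat.not_even_iff_odd] at hodd
  have hlow : ∀ᶠ n in atTop, k ≤ p n := by
    have h' : ∀ m : Fin k, ∀ᶠ n in atTop, p n ≠ m := fun m => by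
      by_contra h
      have hm : k ≤ (m : ℕ) := hk.2 (by simpa [Filter.Frequently] using h)
      omega
    filter_upwards [eventually_all.2 h'] with n hn
    by_contra! hlt
    exact hn ⟨p n, hlt⟩ rfl
  obtain ⟨N, hN⟩ := eventually_atTop.1 hlow
  have hstep : ∀ n, N ≤ n → (x (n + 1)).trunc k ≤ (x n).trunc k := fun n hn => by
    have := Signature.trunc_mono k (hx n).1
    rwa [Signature.trunc_trunc (hN n hn), Signature.trunc_trunc (hN n hn)] at this
  have hanti : AntitoneOn (fun n => (x n).trunc k) (Set.Ici N) := by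
    intro a ha b _ hab
    induction b, hab using Nat.le_induction with
    | base => exact le_rfl
    | succ b hab ih => exact (hstep b (ha.trans hab)).trans (ih (Set.mem_Ici.2 (ha.trans hab)))
  -- The odd priority `k` recurs after the least truncation is attained and pushes strictly below
  -- it.
  obtain ⟨y, ⟨n, hn, rfl⟩, hmin⟩ := WellFounded.has_min (wellFounded_lt (α := Signature.{u} K))
    ((fun n => (x n).trunc k) '' Set.Ici N) ⟨_, N, Set.mem_Ici.2 le_rfl, rfl⟩
  obtain ⟨m, hnm, hm⟩ := frequently_atTop.1 hk.1 n
  have hNm : N ≤ m := le_trans hn hnm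
  have hlt := (hx m).2 (hm ▸ hodd)
  rw [hm] at hlt
  exact hmin _ ⟨m + 1, Set.mem_Ici.2 (by omega), rfl⟩
    (hlt.trans_le (hanti hn (Set.mem_Ici.2 hNm) hnm))

/-! ### Progress measures on trees -/

section Tree

variable {E : Type u}

/-- `VisitRel H Ω p t s`: in the tree `H`, the node `t` lies above `s`, the priorities on the path
from `s` to `t` (excluding `t`) are at least `p`, one of them is `p`, and `p` is odd. -/
def VisitRel (H : Set (List E)) (Ω : List E → ℕ) (p : ℕ) (t s : List E) : Prop :=
  Odd p ∧ t ∈ H ∧ s <+: t ∧ (∀ n, s.length ≤ n → n < t.length → p ≤ Ω (t.take n)) ∧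
    ∃ n, s.length ≤ n ∧ n < t.length ∧ Ω (t.take n) = p

theorem exists_branch_of_prefix_chain {f : ℕ → List E} (hpre : ∀ n, f n <+: f (n + 1))
    (hlen : ∀ n, (f n).length < (f (n + 1)).length) :
    ∃ π : ℕ → E, ∀ m n, n ≤ (f m).length → (List.range n).map π = (f m).take n := by
  have hmono : ∀ {a b}, a ≤ b → f a <+: f b := fun {a b} h => by
    induction b, h using Nat.le_induction with
    | base => exact List.prefix_rfl
    | succ b _ ih => exact ih.trans (hpre b)
  have hl : ∀ n, n ≤ (f n).length := fun n => by
    induction n with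
    | zero => exact Nat.zero_le _
    | succ n ih => exact Nat.succ_le_of_lt (ih.trans_lt (hlen n))
  have hn : ∀ n, n < (f (n + 1)).length := fun n => hl (n + 1)
  refine ⟨fun n => (f (n + 1))[n]'(hn n), fun m n h => ?_⟩
  refine List.ext_getElem (by simp [h]) fun i h₁ h₂ => ?_
  simp only [List.length_map, List.length_range] at h₁
  simp only [List.getElem_map, List.getElem_range, List.getElem_take]
  rcases le_total (i + 1) m with him | him
  · exact (hmono him).getElem _
  · exact ((hmono him).getElem _).symm

/-- A descending chain traces a branch on which the priorities are eventually at least `p` and equal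
`p` infinitely often, with `p` odd, against acceptance. -/
theorem wellFounded_visitRel {H : Set (List E)} (hH : ∀ s t, s <+: t → t ∈ H → s ∈ H)
    {Ω : List E → ℕ}
    (hacc : ∀ π : ℕ → E, (∀ n, (List.range n).map π ∈ H) →
      ParityCondition fun n => Ω ((List.range n).map π)) (p : ℕ) :
    WellFounded (VisitRel H Ω p) := by
  rw [wellFounded_iff_isEmpty_descending_chain]
  refine ⟨fun ⟨f, hf⟩ => ?_⟩
  have hlen : ∀ n, (f n).length < (f (n + 1)).length := fun n => by
    obtain ⟨_, _, _, _, i, h₁, h₂, _⟩ := hf n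
    omega
  have hl : ∀ n, n ≤ (f n).length := fun n => by
    induction n with
    | zero => exact Nat.zero_le _
    | succ n ih => exact Nat.succ_le_of_lt (ih.trans_lt (hlen n))
  obtain ⟨π, hπ⟩ := exists_branch_of_prefix_chain (fun n => (hf n).2.2.1) hlen
  have hbelow : ∀ n, (f 0).length ≤ n → p ≤ Ω ((List.range n).map π) := fun n hn => by
    -- The least such `m` locates the segment of the chain that contains position `n`.
    have hex : ∃ m, n < (f (m + 1)).length := ⟨n, hl (n + 1)⟩
    classical
    have hlow : (f (Nat.find hex)).length ≤ n := by
      rcases h : Nat.find hex with _ | m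
      · exact hn
      · exact not_lt.1 (Nat.find_min hex (m := m) (by omega))
    have hup := Nat.find_spec hex
    rw [hπ (Nat.find hex + 1) n hup.le]
    exact (hf _).2.2.2.1 n hlow hup
  obtain ⟨k, ⟨hk, hleast⟩, heven⟩ := hacc π fun n => by
    rw [hπ (n + 1) n (n.le_succ.trans (hl (n + 1)))]
    exact hH _ _ (List.take_prefix _ _) (hf n).2.1
  have hp : k ≤ p := hleast (frequently_atTop.2 fun a => by
    obtain ⟨_, _, _, _, i, h₁, h₂, h₃⟩ := hf a
    refine ⟨i, (hl a).trans h₁, ?_⟩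
    simp only [hπ (a + 1) i h₂.le, h₃])
  obtain ⟨n, hn, hnk⟩ := frequently_atTop.1 hk (f 0).length
  have := hbelow n hn
  simp only at hnk
  have : k = p := by omega
  subst this
  exact (Nat.not_even_iff_odd.2 (hf 0).1) heven

/-- The predecessors of a child are predecessors of `s`, so the rank for `p` cannot grow along this
edge. -/
theorem VisitRel.of_snoc {H : Set (List E)} {Ω : List E → ℕ} {p : ℕ} {s t : List E} {e : E}
    (hs : p ≤ Ω s) (h : VisitRel H Ω p t (s ++ [e])) : VisitRel H Ω p t s := by
  obtain ⟨hodd, ht, hpre, hge, n, hn, hnt, hnp⟩ := h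
  have hst : s <+: t := (List.prefix_append s [e]).trans hpre
  rw [List.length_append, List.length_singleton] at hn hge
  refine ⟨hodd, ht, hst, fun m hm hmt => ?_, n, by omega, hnt, hnp⟩
  rcases hm.eq_or_lt with rfl | hm
  · rwa [← List.prefix_iff_eq_take.1 hst]
  · exact hge m hm hmt

theorem visitRel_snoc {H : Set (List E)} {Ω : List E → ℕ} {s : List E} {e : E}
    (hs : s ++ [e] ∈ H) (hodd : Odd (Ω s)) : VisitRel H Ω (Ω s) (s ++ [e]) s := by
  refine ⟨hodd, hs, List.prefix_append _ _, fun n h₁ h₂ => ?_, s.length, le_rfl, by simp,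
    by simp⟩
  rw [List.length_append, List.length_singleton] at h₂
  obtain rfl : n = s.length := by omega
  simp

/-- A tree of bounded priority whose branches all satisfy the parity condition carries a progress
measure. -/
theorem exists_progress {H : Set (List E)} (hH : ∀ s t, s <+: t → t ∈ H → s ∈ H)
    {Ω : List E → ℕ} {K : ℕ} (hK : ∀ s, Ω s < K)
    (hacc : ∀ π : ℕ → E, (∀ n, (List.range n).map π ∈ H) →
      ParityCondition fun n => Ω ((List.range n).map π)) :
    ∃ μ : List E → Signature.{u} K, ∀ s e, s ++ [e] ∈ H →
      Signature.Progress (Ω s) (μ s) (μ (s ++ [e])) := by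
  have hwf : ∀ p, IsWellFounded (List E) (VisitRel H Ω p) :=
    fun p => ⟨wellFounded_visitRel hH hacc p⟩
  -- Entry `i` is the ordinal rank of `s`; for even `i` the relation is empty and the rank is zero.
  refine ⟨fun s => toLex fun i => IsWellFounded.rank (VisitRel H Ω i) s, fun s e hs => ?_⟩
  have hle : ∀ i : Fin K, (i : ℕ) ≤ Ω s → IsWellFounded.rank (VisitRel H Ω i) (s ++ [e]) ≤
      IsWellFounded.rank (VisitRel H Ω i) s := fun i hi => by
    rw [IsWellFounded.rank_eq _ (s ++ [e])]
    refine Ordinal.iSup_le fun t => Order.succ_le_of_lt ?_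
    exact IsWellFounded.rank_lt_of_rel (t.2.of_snoc hi)
  have hle' : (fun i : Fin K => if (i : ℕ) ≤ Ω s then
        IsWellFounded.rank (VisitRel H Ω i) (s ++ [e]) else 0) ≤
      fun i : Fin K => if (i : ℕ) ≤ Ω s then IsWellFounded.rank (VisitRel H Ω i) s else 0 := by
    intro i
    dsimp only
    split_ifs with hi
    · exact hle i hi
    · exact le_rfl
  refine ⟨Pi.toLex_monotone hle', fun hodd => Pi.toLex_strictMono (Pi.lt_def.2
    ⟨hle', ⟨Ω s, hK s⟩, ?_⟩)⟩
  simpa using IsWellFounded.rank_lt_of_rel (visitRel_snoc hs hodd)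

end Tree

/-! ### Histories, relabelled nodes and machine states -/

section Histories

variable {P D V B Q : Type*}

theorem DecisionStructure.Reaches.exists_of_prefix {S : DecisionStructure P D V}
    {s t : List (P × D)} {v : V} (h : S.Reaches t v) (hst : s <+: t) : ∃ v', S.Reaches s v' := by
  induction h with
  | nil =>
    obtain rfl := List.prefix_nil.1 hst
    exact ⟨_, .nil⟩
  | snoc h d ih =>
    rcases List.prefix_concat_iff.1 hst with rfl | hst
    · exact ⟨_, h.snoc d⟩
    · exact ih hst

theorem DecisionStructure.Reaches.of_snoc {S : DecisionStructure P D V} {τ : List (P × D)}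
    {e : P × D} {v : V} (h : S.Reaches (τ ++ [e]) v) : ∃ v', S.Reaches τ v' ∧ e.1 = S.act v' := by
  generalize hσ : τ ++ [e] = σ at h
  cases h with
  | nil => simp at hσ
  | snoc h d =>
    obtain ⟨rfl, rfl⟩ := List.concat_inj.1 (by simpa using hσ)
    exact ⟨_, h, rfl⟩

/-- The image of a decision structure under a bijection of the nodes. -/
def DecisionStructure.map {V' : Type*} (S : DecisionStructure P D V) (e : V ≃ V') :
    DecisionStructure P D V' where
  next v d := e (S.next (e.symm v) d)
  act v := S.act (e.symm v)
  init := e S.init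

theorem DecisionStructure.reaches_map {V' : Type*} {S : DecisionStructure P D V} {e : V ≃ V'}
    {τ : List (P × D)} {v' : V'} : (S.map e).Reaches τ v' ↔ S.Reaches τ (e.symm v') := by
  constructor
  · intro h
    induction h with
    | nil => simpa [DecisionStructure.map] using DecisionStructure.Reaches.nil
    | snoc _ d ih => simpa [DecisionStructure.map] using ih.snoc d
  · intro h
    obtain ⟨v, rfl⟩ := e.surjective v'
    rw [e.symm_apply_apply] at h
    induction h with
    | nil => exact DecisionStructure.Reaches.nil
    | snoc _ d ih => simpa [DecisionStructure.map] using ih.snoc d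

theorem DecisionStructure.IsWinning.map {V' R : Type*} {S : DecisionStructure P D V}
    {W : TreeAutomaton P D R} (h : S.IsWinning W) (e : V ≃ V') : (S.map e).IsWinning W := by
  obtain ⟨ρ, ⟨hinit, hrun⟩, hacc⟩ := h
  refine ⟨ρ, ⟨hinit, fun τ v hv => hrun τ _ (reaches_map.1 hv)⟩, fun π hπ => hacc π fun n => ?_⟩
  obtain ⟨v, hv⟩ := hπ n
  exact ⟨_, reaches_map.1 hv⟩

namespace MealyMachine

variable {Γ : Type*}

/-- The state in which the machine is after a history. -/
def stateAfter (M : MealyMachine Γ B Q) (τ : List Γ) : Q :=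
  τ.foldl M.step M.init

theorem stateAfter_snoc (M : MealyMachine Γ B Q) (τ : List Γ) (α : Γ) :
    M.stateAfter (τ ++ [α]) = M.step (M.stateAfter τ) α := by
  simp [stateAfter]

theorem outputFrom_snoc (M : MealyMachine Γ B Q) (q : Q) (τ : List Γ) (α : Γ) :
    M.outputFrom q (τ ++ [α]) = M.outputFrom q τ ++ [M.out (τ.foldl M.step q) α] := by
  induction τ generalizing q with
  | nil => rfl
  | cons β τ ih => simp [outputFrom, ih]

theorem output_snoc (M : MealyMachine Γ B Q) (τ : List Γ) (α : Γ) :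
    M.output (τ ++ [α]) = M.output τ ++ [M.out (M.stateAfter τ) α] :=
  M.outputFrom_snoc _ τ α

end MealyMachine

end Histories

/-! ### Annotations as finite memory -/

section Annotations

variable {P D V B Q R : Type*} {K : ℕ}

/-- An annotation assigns signatures to the pairs of a machine state and an automaton state that
are possible under the current observation sequence; the impossible ones have the value `⊤`. -/
abbrev Annotation (Q R : Type*) (K : ℕ) := Q × R → WithTop (Signature.{u} K)

/-- After the action `a`, the annotations `g b` that follow the observations `b` continue the
annotation `f` with progress, along suitable transitions of the automaton. -/
def Annotation.Continues (M : MealyMachine (P × D) B Q) (W : TreeAutomaton P D R)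
    (f : Annotation.{u} Q R K) (a : P) (g : B → Annotation.{u} Q R K) : Prop :=
  ∀ q r (x : Signature.{u} K), f (q, r) = ↑x → ∃ δ : D → R, (r, a, δ) ∈ W.trans ∧
    ∀ d, ∃ y : Signature.{u} K, g (M.out q (a, d)) (M.step q (a, d), δ d) = ↑y ∧
      Signature.Progress (W.priority r) x y

theorem Annotation.Continues.mono {M : MealyMachine (P × D) B Q} {W : TreeAutomaton P D R}
    {f : Annotation.{u} Q R K} {a : P} {g g' : B → Annotation.{u} Q R K}
    (h : Continues M W f a g) (hg : ∀ b, g' b ≤ g b) : Continues M W f a g' := by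
  intro q r x hx
  obtain ⟨δ, hδ, h⟩ := h q r x hx
  refine ⟨δ, hδ, fun d => ?_⟩
  obtain ⟨y, hy, hp⟩ := h d
  obtain ⟨z, hz, hzy⟩ := WithTop.le_coe_iff.1 ((hg _ _).trans_eq hy)
  exact ⟨z, hz, hp.mono hzy⟩

/-- A set of annotations that contains a possible initial one and can be maintained by the
player. -/
structure IsMaintainable (M : MealyMachine (P × D) B Q) (W : TreeAutomaton P D R)
    (F : Set (Annotation.{u} Q R K)) : Prop where
  init : ∃ f ∈ F, f (M.init, W.init) ≠ ⊤
  step : ∀ f ∈ F, ∃ a g, (∀ b, g b ∈ F) ∧ Annotation.Continues M W f a g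

/-- By Dickson's lemma the minimal annotations of a maintainable set are finite in number, and they
suffice. -/
theorem IsMaintainable.exists_finite [Finite Q] [Finite R] {M : MealyMachine (P × D) B Q}
    {W : TreeAutomaton P D R} {F : Set (Annotation.{u} Q R K)} (hF : IsMaintainable M W F) :
    ∃ F' : Set (Annotation.{u} Q R K), F'.Finite ∧ IsMaintainable M W F' := by
  -- Finiteness of `Q` and `R` enters here: a finite power of a well-order is well-quasi-ordered.
  have hpwo : ∀ s : Set (Annotation.{u} Q R K), s.IsPWO := fun s =>
    Set.isPWO_of_wellQuasiOrderedLE s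
  have hmin : ∀ f ∈ F, ∃ m, Minimal (· ∈ F) m ∧ m ≤ f := fun f hf => by
    obtain ⟨m, hm, h⟩ := (hpwo F).exists_le_minimal hf
    exact ⟨m, h, hm⟩
  refine ⟨{m | Minimal (· ∈ F) m},
    (setOfPred_minimal_antichain (· ∈ F)).finite_of_partiallyWellOrderedOn (hpwo _), ?_, ?_⟩
  · obtain ⟨f, hf, htop⟩ := hF.init
    obtain ⟨m, hm, hmf⟩ := hmin f hf
    exact ⟨m, hm, ((hmf _).trans_lt (lt_top_iff_ne_top.2 htop)).ne⟩
  · intro f hf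
    obtain ⟨a, g, hg, hcont⟩ := hF.step f hf.prop
    choose g' hg' hle using fun b => hmin (g b) (hg b)
    exact ⟨a, g', hg', hcont.mono hle⟩

/-- A winning strategy yields a maintainable set of
annotations: merge the histories with the same observations, machine state and automaton state,
and keep their least signature. -/
theorem DecisionStructure.IsWinning.exists_isMaintainable {P : Type u} {D : Type v} [Finite R]
    {M : MealyMachine (P × D) B Q} {W : TreeAutomaton P D R} {S : DecisionStructure P D V}
    (hS : ∀ τ τ' v v', M.output τ = M.output τ' → S.Reaches τ v → S.Reaches τ' v' →
      S.act v = S.act v')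
    (hwin : S.IsWinning W) :
    ∃ (K : ℕ) (F : Set (Annotation.{max u v} Q R K)), (∀ r, W.priority r < K) ∧ IsMaintainable M W F := by
  obtain ⟨ρ, ⟨hinit, hrun⟩, hacc⟩ := hwin
  obtain ⟨K₀, hK₀⟩ := (Set.finite_range W.priority).bddAbove
  have hK : ∀ r, W.priority r < K₀ + 1 := fun r => Nat.lt_succ_of_le (hK₀ ⟨r, rfl⟩)
  obtain ⟨μ, hμ⟩ := exists_progress (H := S.outcome)
    (fun s t hst ⟨_, ht⟩ => ht.exists_of_prefix hst) (Ω := fun τ => W.priority (ρ τ))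
    (fun τ => hK (ρ τ)) hacc
  let Z (w : List B) (x : Q × R) : Set (List (P × D)) :=
    {τ | τ ∈ S.outcome ∧ M.output τ = w ∧ M.stateAfter τ = x.1 ∧ ρ τ = x.2}
  have hleast : ∀ w x, ∃ y : WithTop (Signature (K₀ + 1)),
      IsLeast (insert ⊤ ((fun τ => (μ τ : WithTop _)) '' Z w x)) y := fun w x => by
    obtain ⟨y, hy, hmin⟩ := WellFounded.has_min
      (wellFounded_lt (α := WithTop (Signature (K₀ + 1)))) _
      (Set.insert_nonempty ⊤ ((fun τ => (μ τ : WithTop _)) '' Z w x))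
    exact ⟨y, hy, fun z hz => not_lt.1 (hmin z hz)⟩
  choose f hf using hleast
  -- Uniformity makes the action a function of the observations; on unrealised sequences any action
  -- will do.
  have hact : ∀ w, ∃ a, ∀ τ v, M.output τ = w → S.Reaches τ v → S.act v = a := fun w => by
    by_cases h : ∃ τ v, M.output τ = w ∧ S.Reaches τ v
    · obtain ⟨τ, v, rfl, hv⟩ := h
      exact ⟨S.act v, fun τ' v' h' hv' => hS τ' τ v' v h' hv' hv⟩
    · exact ⟨S.act S.init, fun τ v hw hv => (h ⟨τ, v, hw, hv⟩).elim⟩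
  choose a ha using hact
  refine ⟨K₀ + 1, Set.range f, hK, ⟨f [], ⟨[], rfl⟩, ?_⟩, ?_⟩
  · refine (lt_of_le_of_lt ((hf _ _).2 (Or.inr ⟨[], ⟨⟨_, .nil⟩, rfl, rfl, hinit⟩, rfl⟩))
      (WithTop.coe_lt_top _)).ne
  rintro _ ⟨w, rfl⟩
  refine ⟨a w, fun b => f (w ++ [b]), fun b => ⟨_, rfl⟩, fun q r x hx => ?_⟩
  have hmem := (hf w (q, r)).1
  rw [hx] at hmem
  rcases hmem with htop | ⟨τ, ⟨⟨v, hv⟩, hw, hq, hr⟩, hτ⟩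
  · exact (WithTop.coe_ne_top htop).elim
  -- The history `τ` attains the minimum. Its transition is used, and its extensions bound the
  -- minima after each direction.
  obtain rfl : μ τ = x := WithTop.coe_injective hτ
  have hav := ha w τ v hw hv
  dsimp only at hq hr
  subst hw hq hr
  have htrans := hrun τ v hv
  rw [hav] at htrans
  refine ⟨_, htrans, fun d => ?_⟩
  have hv' : S.Reaches (τ ++ [(a (M.output τ), d)]) (S.next v d) := hav ▸ hv.snoc d
  obtain ⟨y, hy, hyμ⟩ := WithTop.le_coe_iff.1 ((hf (M.output τ ++
    [M.out (M.stateAfter τ) (a (M.output τ), d)])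
    (M.step (M.stateAfter τ) (a (M.output τ), d), ρ (τ ++ [(a (M.output τ), d)]))).2
    (Or.inr ⟨_, ⟨⟨_, hv'⟩, M.output_snoc _ _, M.stateAfter_snoc _ _, rfl⟩, rfl⟩))
  exact ⟨y, hy, (hμ _ _ ⟨_, hv'⟩).mono hyμ⟩

/-- A maintainable set of annotations is the memory of a winning strategy. -/
theorem IsMaintainable.exists_isWinning {M : MealyMachine (P × D) B Q} {W : TreeAutomaton P D R}
    {F : Set (Annotation.{u} Q R K)} (hK : ∀ r, W.priority r < K) (hF : IsMaintainable M W F) :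
    ∃ S : DecisionStructure P D (F × Q),
      (∀ τ τ' v v', M.output τ = M.output τ' → S.Reaches τ v → S.Reaches τ' v' →
        S.act v = S.act v') ∧ S.IsWinning W := by
  obtain ⟨⟨f₀, hf₀, hinit⟩, hstep⟩ := hF
  have hstep' : ∀ f : F, ∃ (a : P) (g : B → F),
      Annotation.Continues M W f.1 a fun b => (g b).1 := fun f => by
    obtain ⟨a, g, hg, h⟩ := hstep f.1 f.2
    exact ⟨a, fun b => ⟨g b, hg b⟩, h⟩
  choose a g hg using hstep'
  have hδ' : ∀ (f : F) (q : Q) (r : R), ∃ δ : D → R, ∀ x : Signature.{u} K, f.1 (q, r) = ↑x →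
      (r, a f, δ) ∈ W.trans ∧ ∀ d, ∃ y : Signature.{u} K,
        (g f (M.out q (a f, d))).1 (M.step q (a f, d), δ d) = ↑y ∧
          Signature.Progress (W.priority r) x y := fun f q r => by
    by_cases h : f.1 (q, r) = ⊤
    -- An impossible pair imposes no condition, so the choice is arbitrary.
    · exact ⟨fun _ => r, fun x hx => by simp [h] at hx⟩
    · obtain ⟨x, hx⟩ := WithTop.ne_top_iff_exists.1 h
      obtain ⟨δ, hδ⟩ := hg f q r x hx.symm
      refine ⟨δ, fun x' hx' => ?_⟩
      obtain rfl : x = x' := WithTop.coe_injective (hx.trans hx')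
      exact hδ
  choose δ hδ using hδ'
  let mem (w : List B) : F := w.foldl g ⟨f₀, hf₀⟩
  -- The machine state is needed to compute the next observation, but the action reads only the
  -- annotation, hence is uniform.
  let S : DecisionStructure P D (F × Q) :=
    { next := fun v d => (g v.1 (M.out v.2 (a v.1, d)), M.step v.2 (a v.1, d))
      act := fun v => a v.1
      init := (⟨f₀, hf₀⟩, M.init) }
  have hreach : ∀ τ v, S.Reaches τ v → v = (mem (M.output τ), M.stateAfter τ) := by
    intro τ v h
    induction h with
    | nil => rfl
    | snoc h d ih =>
      subst ih
      simp [S, mem, MealyMachine.output_snoc, MealyMachine.stateAfter_snoc]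
  let run (τ : List (P × D)) : F × Q × R := τ.foldl (fun c e =>
    (g c.1 (M.out c.2.1 e), M.step c.2.1 e, δ c.1 c.2.1 c.2.2 e.2)) (⟨f₀, hf₀⟩, M.init, W.init)
  have hrun_snoc : ∀ τ e, run (τ ++ [e]) = (g (run τ).1 (M.out (run τ).2.1 e),
      M.step (run τ).2.1 e, δ (run τ).1 (run τ).2.1 (run τ).2.2 e.2) := fun τ e => by
    simp [run]
  have hrun : ∀ τ, (run τ).1 = mem (M.output τ) ∧ (run τ).2.1 = M.stateAfter τ := by
    intro τ
    induction τ using List.reverseRecOn with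
    | nil => exact ⟨rfl, rfl⟩
    | append_singleton τ e ih =>
      simp [hrun_snoc, ih.1, ih.2, mem, MealyMachine.output_snoc, MealyMachine.stateAfter_snoc]
  have hact : ∀ τ v, S.Reaches τ v → S.act v = a (run τ).1 := fun τ v h => by
    rw [hreach τ v h, (hrun τ).1]
  -- Invariant: the current pair of states is never marked impossible, so its signature serves as
  -- progress measure along plays.
  have hlive : ∀ τ v, S.Reaches τ v → ∃ x : Signature.{u} K, (run τ).1.1 (run τ).2 = ↑x := by
    intro τ v h
    induction h with
    | nil =>
      obtain ⟨x, hx⟩ := WithTop.ne_top_iff_exists.1 hinit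
      exact ⟨x, hx.symm⟩
    | snoc h d ih =>
      obtain ⟨x, hx⟩ := ih
      obtain ⟨y, hy, _⟩ := (hδ _ _ _ x hx).2 d
      refine ⟨y, ?_⟩
      rw [hrun_snoc, hact _ _ h]
      exact hy
  refine ⟨S, fun τ τ' v v' hout hv hv' => ?_, fun τ => (run τ).2.2, ⟨rfl, fun τ v hv => ?_⟩,
    fun π hπ => ?_⟩
  · rw [hreach τ v hv, hreach τ' v' hv', hout]
  · obtain ⟨x, hx⟩ := hlive τ v hv
    simp only [hrun_snoc, hact τ v hv]
    exact (hδ _ _ _ x hx).1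
  · have hx : ∀ n, ∃ x : Signature.{u} K,
        (run ((List.range n).map π)).1.1 (run ((List.range n).map π)).2 = ↑x :=
      fun n => (hπ n).elim fun v hv => hlive _ v hv
    choose x hx using hx
    refine parityCondition_of_progress (fun n => hK _) x fun n => ?_
    obtain ⟨y, hy, hprog⟩ := (hδ _ _ _ (x n) (hx n)).2 (π n).2
    have hsucc : (List.range (n + 1)).map π = (List.range n).map π ++ [π n] := by
      simp [List.range_succ]
    obtain ⟨v', hv'⟩ := hπ (n + 1)
    rw [hsucc] at hv'
    obtain ⟨v, hv, hπv⟩ := hv'.of_snoc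
    have hxy := hx (n + 1)
    rw [hact _ v hv] at hπv
    rw [hsucc, hrun_snoc] at hxy
    rw [← hπv] at hy
    obtain rfl : y = x (n + 1) := WithTop.coe_injective (hy.symm.trans hxy)
    exact hprog

end Annotations

theorem mainTheorem6 {N : Type*} [Unique N] {A B Q : N → Type*} {D : Type*} {R : Type*}
    [∀ i, Finite (A i)] [∀ i, Finite (B i)] [∀ i, Finite (Q i)] [Finite D] [Finite R]
    (G : DistributedGame N A B Q D) (W : TreeAutomaton (∀ i, A i) D R)
    (hwin : ∃ (V : Type*) (S : DecisionStructure (∀ i, A i) D V),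
      S.IsStrategy G ∧ S.IsWinning W) :
    ∃ (V : Type) (_ : Finite V) (S : DecisionStructure (∀ i, A i) D V),
      S.IsStrategy G ∧ S.IsWinning W := by
  obtain ⟨V, S, hS, hwin⟩ := hwin
  obtain ⟨K, F, hK, hF⟩ := hwin.exists_isMaintainable (M := G.machine default)
    fun τ τ' v v' hout hv hv' => funext fun i => by
      obtain rfl := Unique.eq_default i
      exact hS _ v v' ⟨τ, τ', hout, hv, hv'⟩
  obtain ⟨F', hfin, hF'⟩ := hF.exists_finite
  obtain ⟨T, hT, hTwin⟩ := hF'.exists_isWinning hK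
  have := hfin.to_subtype
  -- Annotations involve ordinals from a larger universe, so the nodes are renamed by an initial
  -- segment of the naturals.
  obtain ⟨n, ⟨e⟩⟩ := Finite.exists_equiv_fin (F' × Q default)
  refine ⟨Fin n, inferInstance, T.map e, ?_, hTwin.map e⟩
  rintro i v v' ⟨τ, τ', hout, hv, hv'⟩
  obtain rfl := Unique.eq_default i
  exact congrFun (hT τ τ' _ _ hout (DecisionStructure.reaches_map.1 hv)
    (DecisionStructure.reaches_map.1 hv')) _
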